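/- Consider an all-pay contest with spillovers among finitely many, $n>2$, players. Each player $k$ chooses a score $s_k\in[0,\infty)$; at the score profile $s=(s_k;s_{-k})$ her payoff is $u_k(s)=p_k(s)\,v_k(s_k;s_{-k})-c_k(s_k)$, where $v_k\ge 0$ is the value of the prize, $c_k\ge 0$ is the cost, and $p_k(s)$ is the probability of winning: $p_k\in[0,1]$ is measurable, $\sum_k p_k(s)=1$, and $p_k(s)=0$ if some opponent has a strictly higher score (ties for the highest score are broken arbitrarily). A mixed-strategy profile $(G_k)_k$ of probability distributions on $[0,\infty)$, drawn independently, is a (Nash) equilibrium if for every $k$ the distribution $G_k$ is carried by the set of scores that maximize $k$'s expected payoff against $G_{-k}$, i.e. $G_k$-almost every score is a best response. Assume the following for every player $k$. * (A1) On the set where $s_k$ is at least as large as all opponents' scores, $v_k$ is continuous in the scores and continuously differentiable in $s_k$; $c_k$ is continuously differentiable. * (A2) For every $s_k>0$: $c_k'(s_k)>0$, and $\partial v_k(s_k;y)/\partial s_k<c_k'(s_k)$ for almost all tuples $y$ of opponents' scores that do not exceed $s_k$. * (A3) $v_k(0;0)>c_k(0)=0$, and $\lim_{s\to\infty}\sup_{y}v_k(s;y)<\lim_{s\to\infty}c_k(s)$,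 where the limits exist in $[0,\infty]$. * (A4) There are bounds $T_l\ge 0$ ($l$ ranging over the players) such that no player $l$ would ever choose a score $s_l\ge T_l$ (that is, $v_l(s_l;y)<c_l(s_l)$ whenever $s_l\ge T_l$ and all opponents' scores in $y$ are at most $s_l$), and such that $v_k(s)>0$ at every profile $s\in\prod_l[0,T_l]$ at which $k$ ties with some opponent for the highest score. Let $i\ne j$ be two of the players. In the two-player contest between $i$ and $j$ the values and costs are those of the original contest with all other scores equal to zero, and $i$ wins a tie with probability $\lambda\in[0,1]$ (and $j$ with probability $1-\lambda$). Suppose that $i$ has a positive payoff in this two-player contest, i.e. $(G_i^\star,G_j^\star)$ is an equilibrium of it in which $i$'s expected payoff is positive. Suppose also that for every player $k\notin\{i,j\}$ and all $s,s_i,s_j\in[0,\infty)$ $$\frac{c_k(s)}{v_k(s;\mathbf s_{\{i,j\}})}\ \ge\ \frac{c_j(s)}{v_j(s;\mathbf s_{\{i\}})},$$ where $\mathbf s_H$ denotes the vector of opponents' scores in which each player $h\in H$ scores $s_h$ and all other opponents score zero (with $c/0=\infty$ for $c>0$, and $0/0=0$). Then there is an equilibrium of the $n$-player contest in which only $i$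 and $j$ participate: $i$ plays $G_i^\star$, $j$ plays $G_j^\star$, and every other player chooses the score $0$ with probability one. -/

import Mathlib

open Set Filter Topology MeasureTheory
open scoped NNReal ENNReal

/-- An all-pay contest with spillovers among the players in `ι`. Every player submits a score in
`[0, ∞)`. At the score profile `s`, player `i` values the prize at `v i s`, bears the cost
`c i (s i)` whether she wins or not, and wins the prize with probability `p i s`. Exactly one prize
is awarded, always to a player with the highest score (so a player whose score is strictly above
all the others wins for sure); ties for the highest score are broken by an arbitrary
(measurable) rule. -/
structure Contest (ι : Type*) [Fintype ι] where
  /-- value of the prize, as a function of the whole score profile -/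
  v : ι → (ι → ℝ≥0) → ℝ≥0
  /-- private cost of the own score -/
  c : ι → ℝ≥0 → ℝ≥0
  /-- probability of winning the prize -/
  p : ι → (ι → ℝ≥0) → ℝ≥0
  measurable_p : ∀ i, Measurable (p i)
  sum_p : ∀ s, ∑ i, p i s = 1
  p_eq_zero : ∀ i k s, s i < s k → p i s = 0

namespace Contest

section Game

variable {ι : Type*} [Fintype ι] [DecidableEq ι] (C : Contest ι)

/-- Payoff of player `i` at the score profile `s`. -/
noncomputable def payoff (i : ι) (s : ι → ℝ≥0) : ℝ :=
  C.p i s * C.v i s - C.c i (s i)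

/-- Expected payoff of player `i` at the profile `G` of (independent) mixed strategies. -/
noncomputable def expectedPayoff (i : ι) (G : ι → ProbabilityMeasure ℝ≥0) : ℝ :=
  ∫ s, C.payoff i s ∂(Measure.pi fun k => (G k : Measure ℝ≥0))

/-- Expected payoff of player `i` from the score `x` when the opponents play according to `G`
(the component `G i` has no influence). -/
noncomputable def payoffAgainst (i : ι) (G : ι → ProbabilityMeasure ℝ≥0) (x : ℝ≥0) : ℝ :=
  ∫ s, C.payoff i (Function.update s i x) ∂(Measure.pi fun k => (G k : Measure ℝ≥0))

/-- The best responses of player `i` to the mixed strategies of the opponents. -/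
def bestResponses (i : ι) (G : ι → ProbabilityMeasure ℝ≥0) : Set ℝ≥0 :=
  {x | ∀ t, C.payoffAgainst i G t ≤ C.payoffAgainst i G x}

/-- Nash equilibrium in mixed strategies: every player's strategy is carried by her
best responses. -/
def IsNash (G : ι → ProbabilityMeasure ℝ≥0) : Prop :=
  ∀ i, ∀ᵐ x ∂(G i : Measure ℝ≥0), x ∈ C.bestResponses i G

/-- The value `v i (x; s₋ᵢ)` as a function of the own score `x`, taken to be a real number. -/
noncomputable def valueOwn (i : ι) (s : ι → ℝ≥0) (x : ℝ) : ℝ :=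
  C.v i (Function.update s i x.toNNReal)

/-- The cost as a function of a real number. -/
noncomputable def costOwn (i : ι) (x : ℝ) : ℝ :=
  C.c i x.toNNReal

/-- The own scores of player `i` that are at least as high as all the scores of the opponents;
only there the value of the prize matters. -/
def contending (i : ι) (s : ι → ℝ≥0) : Set ℝ :=
  {x | 0 ≤ x ∧ ∀ k, k ≠ i → (s k : ℝ) ≤ x}

/-- Smoothness: where the own score is at least as high as the scores of the opponents, the value
of the prize is continuous in the scores and continuously differentiable in the own score; the
cost is continuously differentiable. (At end points derivatives are one-sided.) -/
def Smoothness : Prop :=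
  ∀ i, ContinuousOn (C.v i) {s | ∀ k, k ≠ i → s k ≤ s i} ∧
    (∀ s, ContDiffOn ℝ 1 (C.valueOwn i s) (contending i s)) ∧
    ContDiffOn ℝ 1 (C.costOwn i) (Ici 0)

/-- Monotonicity: for every own score `x > 0` the marginal cost is positive, and it exceeds the
marginal value of the prize for (Lebesgue-)almost all scores of the opponents (at most `x`).
The coordinate `y i` plays no role in the condition on `y`, so that it is the same to say
"for almost all `y`" and "for almost all tuples of scores of the opponents of `i`". -/
def Monotonicity : Prop :=
  ∀ i, ∀ x : ℝ, 0 < x → 0 < derivWithin (C.costOwn i) (Ici 0) x ∧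
    ∀ᵐ y : ι → ℝ, (∀ k, 0 ≤ y k) → x ∈ contending i (fun k => (y k).toNNReal) →
      derivWithin (C.valueOwn i fun k => (y k).toNNReal) (contending i fun k => (y k).toNNReal) x <
        derivWithin (C.costOwn i) (Ici 0) x

/-- Interiority: `v i (0; 0) > c i 0 = 0`, and the limit of the largest possible value of the
prize is smaller than the limit of the cost as the own score goes to infinity (the limits may be
infinite). -/
def Interiority : Prop :=
  ∀ i, C.c i 0 = 0 ∧ 0 < C.v i 0 ∧
    ∃ a b : ℝ≥0∞,
      Tendsto (fun x : ℝ≥0 => ⨆ s : ι → ℝ≥0, (C.v i (Function.update s i x) : ℝ≥0∞)) atTop (𝓝 a) ∧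
      Tendsto (fun x : ℝ≥0 => (C.c i x : ℝ≥0∞)) atTop (𝓝 b) ∧ a < b

/-- `T` is a bound on the scores that a player would ever choose: from `T i` on, even winning for
sure is worse for player `i` than the score zero. -/
def IsScoreBound (T : ι → ℝ≥0) : Prop :=
  ∀ i, ∀ s : ι → ℝ≥0, T i ≤ s i → (∀ k, s k ≤ s i) → C.v i s < C.c i (s i)

/-- Discontinuity at ties: on the score profiles in `∏ i, [0, T i]`, for some bound `T` on the
scores that the players would ever choose, the prize has a positive value for every player who
ties for the highest score. -/
def DiscontinuityAtTies : Prop :=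
  ∃ T : ι → ℝ≥0, C.IsScoreBound T ∧
    ∀ i, ∀ s : ι → ℝ≥0, (∀ k, s k ≤ T k) → (∀ k, s k ≤ s i) → (∃ k, k ≠ i ∧ s k = s i) →
      0 < C.v i s

end Game

section Pair

variable {ι : Type*} [Fintype ι] [DecidableEq ι]

/-- The score profile in which `i` scores `a`, `j` scores `b`, and everyone else scores zero. -/
def pairProfile (i j : ι) (a b : ℝ≥0) : ι → ℝ≥0 :=
  Function.update (Function.update 0 j b) i a

/-- The winning probabilities in a contest of two players; the first player wins a tie with
probability `l`. -/
noncomputable def pairWin (l : ℝ≥0) (m : Fin 2) (s : Fin 2 → ℝ≥0) : ℝ≥0 :=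
  if s (1 - m) < s m then 1 else if s m < s (1 - m) then 0 else if m = 0 then l else 1 - l

/-- The two-player contest in which `i` (as player `0`) and `j` (as player `1`) are the only
participants of `C`; ties are won by `i` with probability `l`. -/
noncomputable def pair (C : Contest ι) (i j : ι) (l : ℝ≥0) (hl : l ≤ 1) : Contest (Fin 2) where
  v m s := C.v (![i, j] m) (pairProfile i j (s 0) (s 1))
  c m := C.c (![i, j] m)
  p := pairWin l
  measurable_p m := by
    unfold pairWin
    refine Measurable.ite (measurableSet_lt (measurable_pi_apply _) (measurable_pi_apply _))
      measurable_const (Measurable.ite (measurableSet_lt (measurable_pi_apply _)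
        (measurable_pi_apply _)) measurable_const measurable_const)
  sum_p s := by
    rcases lt_trichotomy (s 0) (s 1) with h | h | h
    · simp [pairWin, h, h.not_gt]
    · simp [pairWin, h, hl]
    · simp [pairWin, h, h.not_gt]
  p_eq_zero m k s h := by
    have hk : k = 1 - m := by
      fin_cases m <;> fin_cases k <;> simp_all
    subst hk
    simp [pairWin, h, h.not_gt]

/-- Ranked costs: for every player `k` other than `i` and `j`, every own score `x`, and all scores
`a` of `i` and `b` of `j`, the cost-value ratio of `k` at `x` when `i`, `j` score `a`, `b` and
everyone else scores zero is at least the cost-value ratio of `j` at `x` when `i` scores `a` and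
everyone else scores zero. The ratio of a positive cost and the value zero is infinite; the
ratio is zero if the cost is zero. -/
def RankedCosts (C : Contest ι) (i j : ι) : Prop :=
  ∀ k, k ≠ i → k ≠ j → ∀ x a b : ℝ≥0,
    (C.c j x : ℝ≥0∞) / C.v j (Function.update (pairProfile i j a 0) j x) ≤
      (C.c k x : ℝ≥0∞) / C.v k (Function.update (pairProfile i j a b) k x)

end Pair

end Contest

/-!
The profile in which `i` and `j` play as in the two-player contest, and all others score zero,
is an equilibrium for the following reasons.

Write `winPayoff` for the payoff that an active player gets from a score if she wins all ties. It is
right-continuous, it bounds the payoff under any tie-breaking rule, and it is equal to that payoff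
off the (countably many) atoms of the opponent. So in an equilibrium of the two-player contest,
`winPayoff` is nowhere above the equilibrium payoff (`winPayoff_le_duelPayoff`): a player can score
slightly more instead of winning the ties. Since the prize is worth something at a tie, and one of
the players does not win all the ties, the two strategies have no common atom
(`measure_singleton_eq_zero_of_equilibrium`). Therefore neither the tie-breaking rule nor the
presence of players with the score zero makes a difference to `i` and `j`
(`ae_mem_bestResponses_active`).

If both `i` and `j` had positive payoffs, then each of them would beat or tie the other with
positive probability from almost all her scores, and also, by right-continuity, from the lowest
score in her support; hence both supports would have the same infimum, and this would be a common
atom (`exists_common_atom`). So the payoff of `j` is zero. Nor does `i` have an atom at zero, since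
it would not be one of `j`, and she would get nothing there.

An inactive player `k` hence gets zero from the score zero. At a score `x > 0` the ranking of the
cost-value ratios says that `v k` is at most `c k x / c j x` times the value of the prize for `j`
when `k` is absent. Thus a deviation of `k` to `x` yields at most `c k x / c j x` times the
`winPayoff` of `j` at `x`, which is not positive (`payoffAgainst_inactive_nonpos`).
-/

namespace Contest

/-! ### One contender against the mixed strategy of a single opponent -/

section WinPayoff

variable {w : ℝ≥0 → ℝ≥0 → ℝ≥0} {c : ℝ≥0 → ℝ≥0} {μ : Measure ℝ≥0}

/-- The expected payoff of a contender from the score `x` when the single opponent draws her score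
`y` from `μ` and the contender wins all ties; `w x y` is the value of the prize. Since only the
scores `y ≤ x` contribute, nothing is assumed about `w x y` for `x < y`. -/
noncomputable def winPayoff (w : ℝ≥0 → ℝ≥0 → ℝ≥0) (c : ℝ≥0 → ℝ≥0) (μ : Measure ℝ≥0)
    (x : ℝ≥0) : ℝ :=
  (∫ y in Iic x, (w x y : ℝ) ∂μ) - c x

theorem continuousOn_Iic_of_continuousOn
    (hw : ContinuousOn (fun q : ℝ≥0 × ℝ≥0 => w q.1 q.2) {q | q.2 ≤ q.1}) (x : ℝ≥0) :
    ContinuousOn (fun y => (w x y : ℝ)) (Iic x) :=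
  NNReal.continuous_coe.comp_continuousOn
    (hw.comp (by fun_prop : Continuous fun y : ℝ≥0 => (x, y)).continuousOn fun _ hy => hy)

theorem measurable_indicator_Iic
    (hw : ContinuousOn (fun q : ℝ≥0 × ℝ≥0 => w q.1 q.2) {q | q.2 ≤ q.1}) (x : ℝ≥0) :
    Measurable ((Iic x).indicator fun y => (w x y : ℝ)) := by
  classical
  rw [← piecewise_eq_indicator]
  exact (continuousOn_Iic_of_continuousOn hw x).measurable_piecewise
    continuousOn_const measurableSet_Iic

theorem exists_forall_le_of_continuousOn
    (hw : ContinuousOn (fun q : ℝ≥0 × ℝ≥0 => w q.1 q.2) {q | q.2 ≤ q.1}) (z : ℝ≥0) :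
    ∃ M : ℝ, 0 ≤ M ∧ ∀ x ≤ z, ∀ y ≤ x, (w x y : ℝ) ≤ M := by
  have hK : IsCompact ((Icc (0 : ℝ≥0) z ×ˢ Icc (0 : ℝ≥0) z) ∩ {q | q.2 ≤ q.1}) :=
    (isCompact_Icc.prod isCompact_Icc).inter_right
      (isClosed_le continuous_snd continuous_fst)
  obtain ⟨M, hM⟩ := hK.bddAbove_image (f := fun q : ℝ≥0 × ℝ≥0 => w q.1 q.2)
    (hw.mono inter_subset_right)
  refine ⟨M, M.2, fun x hx y hy => ?_⟩
  exact_mod_cast hM ⟨(x, y), ⟨⟨⟨zero_le, hx⟩, ⟨zero_le, hy.trans hx⟩⟩, hy⟩, rfl⟩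

theorem integrable_indicator_Iic [IsFiniteMeasure μ]
    (hw : ContinuousOn (fun q : ℝ≥0 × ℝ≥0 => w q.1 q.2) {q | q.2 ≤ q.1}) (x : ℝ≥0) :
    Integrable ((Iic x).indicator fun y => (w x y : ℝ)) μ := by
  obtain ⟨M, hM0, hM⟩ := exists_forall_le_of_continuousOn hw x
  refine Integrable.of_bound (measurable_indicator_Iic hw x).aestronglyMeasurable M
    (Eventually.of_forall fun y => ?_)
  by_cases hy : y ∈ Iic x
  · simpa [indicator_of_mem hy] using hM x le_rfl y hy
  · simpa [indicator_of_notMem hy] using hM0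

theorem winPayoff_eq_integral_indicator (x : ℝ≥0) :
    winPayoff w c μ x = (∫ y, (Iic x).indicator (fun y => (w x y : ℝ)) y ∂μ) - c x := by
  rw [winPayoff, integral_indicator measurableSet_Iic]

theorem continuousWithinAt_winPayoff [IsFiniteMeasure μ]
    (hw : ContinuousOn (fun q : ℝ≥0 × ℝ≥0 => w q.1 q.2) {q | q.2 ≤ q.1})
    (hc : Continuous c) (b : ℝ≥0) : ContinuousWithinAt (winPayoff w c μ) (Ici b) b := by
  have hfun : winPayoff w c μ =
      fun x => (∫ y, (Iic x).indicator (fun y => (w x y : ℝ)) y ∂μ) - c x :=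
    funext winPayoff_eq_integral_indicator
  rw [hfun]
  refine ContinuousWithinAt.sub ?_ (NNReal.continuous_coe.comp hc).continuousWithinAt
  obtain ⟨M, hM0, hM⟩ := exists_forall_le_of_continuousOn hw (b + 1)
  have hb1 : b < b + 1 := lt_add_one b
  refine tendsto_integral_filter_of_dominated_convergence (fun _ => M)
    (Eventually.of_forall fun x => (measurable_indicator_Iic hw x).aestronglyMeasurable) ?_
    (integrable_const M) (Eventually.of_forall fun y => ?_)
  · filter_upwards [mem_nhdsWithin_of_mem_nhds (Iic_mem_nhds hb1)] with x hx
    refine Eventually.of_forall fun y => ?_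
    by_cases hy : y ∈ Iic x
    · simpa [indicator_of_mem hy] using hM x hx y hy
    · simpa [indicator_of_notMem hy] using hM0
  · by_cases hy : y ≤ b
    · have h1 : ContinuousWithinAt (fun x => (w x y : ℝ)) (Ici b) b :=
        NNReal.continuous_coe.continuousAt.comp_continuousWithinAt
          ((hw (b, y) hy).comp (f := fun x : ℝ≥0 => (x, y))
            (by fun_prop : Continuous fun x : ℝ≥0 => (x, y)).continuousWithinAt
            fun x hx => hy.trans hx)
      rw [indicator_of_mem (mem_Iic.2 hy)]
      refine h1.tendsto.congr' ?_
      filter_upwards [self_mem_nhdsWithin] with x hx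
      rw [indicator_of_mem (mem_Iic.2 (hy.trans hx))]
    · rw [indicator_of_notMem (by simpa using hy)]
      refine tendsto_const_nhds.congr' ?_
      filter_upwards [mem_nhdsWithin_of_mem_nhds (Iio_mem_nhds (not_le.1 hy))] with x hx
      rw [indicator_of_notMem (by simpa using hx)]

theorem measure_Iic_ne_zero_of_winPayoff_pos {x : ℝ≥0} (h : 0 < winPayoff w c μ x) :
    μ (Iic x) ≠ 0 := by
  intro h0
  rw [winPayoff, setIntegral_measure_zero _ h0] at h
  exact absurd h (by simp)

/-- A contender with the score `x` who wins with probability `q y` against `y`, and never against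
`y > x`, gets at most the payoff of one who wins all ties. -/
theorem integral_sub_le_winPayoff [IsProbabilityMeasure μ]
    (hw : ContinuousOn (fun q : ℝ≥0 × ℝ≥0 => w q.1 q.2) {q | q.2 ≤ q.1})
    {q : ℝ≥0 → ℝ≥0} (hq : Measurable q) (hq1 : ∀ y, q y ≤ 1) {x : ℝ≥0}
    (hgt : ∀ y, x < y → q y = 0) :
    ∫ y, ((q y : ℝ) * w x y - c x) ∂μ ≤ winPayoff w c μ x := by
  have heq : ∀ y, (q y : ℝ) * w x y = q y * (Iic x).indicator (fun y => (w x y : ℝ)) y := by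
    intro y
    by_cases hy : y ∈ Iic x
    · rw [indicator_of_mem hy]
    · rw [indicator_of_notMem hy, hgt y (not_le.1 hy)]; simp
  have hint := integrable_indicator_Iic (μ := μ) hw x
  have hint' : Integrable (fun y => (q y : ℝ) * w x y) μ := by
    simp only [heq]
    refine hint.bdd_mul (c := 1) hq.coe_nnreal_real.aestronglyMeasurable ?_
    exact Eventually.of_forall fun y => by simpa using hq1 y
  rw [integral_sub hint' (integrable_const _), integral_const, probReal_univ, one_smul,
    winPayoff_eq_integral_indicator]
  refine sub_le_sub_right (integral_mono hint' hint fun y => ?_) _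
  simp only [heq]
  exact mul_le_of_le_one_left (indicator_nonneg (fun _ _ => NNReal.coe_nonneg _) _)
    (by exact_mod_cast hq1 y)

/-- The tie-breaking rule is irrelevant at scores that are not atoms of the opponent's strategy. -/
theorem integral_sub_eq_winPayoff [IsProbabilityMeasure μ]
    (hw : ContinuousOn (fun q : ℝ≥0 × ℝ≥0 => w q.1 q.2) {q | q.2 ≤ q.1})
    {q : ℝ≥0 → ℝ≥0} {x : ℝ≥0} (hlt : ∀ y, y < x → q y = 1)
    (hgt : ∀ y, x < y → q y = 0) (hx : μ {x} = 0) :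
    ∫ y, ((q y : ℝ) * w x y - c x) ∂μ = winPayoff w c μ x := by
  have hint := integrable_indicator_Iic (μ := μ) hw x
  have hae : (fun y => (q y : ℝ) * w x y - c x) =ᵐ[μ]
      fun y => (Iic x).indicator (fun y => (w x y : ℝ)) y - c x := by
    filter_upwards [compl_mem_ae_iff.2 hx] with y hy
    rcases lt_or_gt_of_ne (show y ≠ x from hy) with h | h
    · rw [indicator_of_mem (mem_Iic.2 h.le), hlt y h]; simp
    · rw [indicator_of_notMem (by simpa using h), hgt y h]; simp
  rw [integral_congr_ae hae, integral_sub hint (integrable_const _), integral_const,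
    probReal_univ, one_smul, winPayoff_eq_integral_indicator]

theorem ae_measure_singleton_eq_zero_of_no_common_atom {ν : Measure ℝ≥0} [IsFiniteMeasure ν]
    (h : ∀ x, μ {x} ≠ 0 → ν {x} = 0) : ∀ᵐ x ∂μ, ν {x} = 0 := by
  have hcount : {x : ℝ≥0 | 0 < ν {x}}.Countable := by
    simpa using Measure.countable_meas_level_set_pos (μ := ν) measurable_id
  have h0 : μ {x : ℝ≥0 | 0 < ν {x}} = 0 := by
    rw [← biUnion_of_singleton {x : ℝ≥0 | 0 < ν {x}}, measure_biUnion_null_iff hcount]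
    intro x hx
    by_contra hne
    exact hx.ne' (h x hne)
  filter_upwards [compl_mem_ae_iff.2 h0] with x hx
  simpa using hx

/-- A bound for a right-continuous function has to be checked only off the atoms of a finite
measure, as these are countable. -/
theorem le_of_forall_measure_singleton_eq_zero [IsFiniteMeasure μ] {f : ℝ≥0 → ℝ} {u : ℝ}
    {b : ℝ≥0} (hf : ContinuousWithinAt f (Ici b) b) (h : ∀ x, μ {x} = 0 → f x ≤ u) :
    f b ≤ u := by
  have hcount : {x : ℝ≥0 | 0 < μ {x}}.Countable := by
    simpa using Measure.countable_meas_level_set_pos (μ := μ) measurable_id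
  refine le_of_tendsto_of_frequently (hf.mono Ioi_subset_Ici_self).tendsto ?_
  intro hev
  obtain ⟨z, hz, hsub⟩ := (mem_nhdsGT_iff_exists_Ioo_subset' (lt_add_one b)).1 hev
  have hIoo : (Ioo b z).Countable := hcount.mono fun x hx => by
    by_contra h0
    exact hsub hx (h x (by simpa using h0))
  have : (Ioo (b : ℝ) z).Countable := by
    refine (hIoo.image ((↑) : ℝ≥0 → ℝ)).mono fun r hr => ?_
    have hr0 : 0 ≤ r := b.2.trans hr.1.le
    exact ⟨⟨r, hr0⟩, hr, rfl⟩
  rw [Cardinal.Real.Ioo_countable_iff] at this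
  exact absurd hz (not_lt.2 (by exact_mod_cast this))

/-- Let `f`, `g` be the right-continuous payoff functions of two players with the strategies `μ`,
`ν`. If almost every score drawn by the players yields a payoff of at least `u` and `t`
respectively, and such payoffs require to beat or tie the opponent with positive probability, then
both strategies have an atom at the common infimum of their supports. -/
theorem exists_common_atom {μ ν : Measure ℝ≥0} [IsProbabilityMeasure μ] [IsProbabilityMeasure ν]
    {f g : ℝ≥0 → ℝ} {u t : ℝ}
    (hf : ∀ b, ContinuousWithinAt f (Ici b) b) (hg : ∀ b, ContinuousWithinAt g (Ici b) b)
    (hu : ∀ᵐ x ∂μ, u ≤ f x) (ht : ∀ᵐ x ∂ν, t ≤ g x)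
    (hfν : ∀ x, u ≤ f x → ν (Iic x) ≠ 0) (hgμ : ∀ x, t ≤ g x → μ (Iic x) ≠ 0) :
    ∃ b, μ {b} ≠ 0 ∧ ν {b} ≠ 0 := by
  have key : ∀ {μ : Measure ℝ≥0} {f : ℝ≥0 → ℝ} {u : ℝ}, (∀ᵐ x ∂μ, u ≤ f x) →
      ∀ x, μ (Iic x) ≠ 0 → ∃ y ≤ x, u ≤ f y := by
    intro μ f u hu x hx
    obtain ⟨y, hy, hyx⟩ := (hu.and_frequently (frequently_ae_mem_iff.2 hx)).exists
    exact ⟨y, hyx, hy⟩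
  -- the scores that beat or tie the opponent with positive probability are the same for both
  have hiff : ∀ x, μ (Iic x) ≠ 0 ↔ ν (Iic x) ≠ 0 := by
    intro x
    constructor
    · intro hx
      obtain ⟨y, hyx, hy⟩ := key hu x hx
      exact fun h0 => hfν y hy (measure_mono_null (Iic_subset_Iic.2 hyx) h0)
    · intro hx
      obtain ⟨y, hyx, hy⟩ := key ht x hx
      exact fun h0 => hgμ y hy (measure_mono_null (Iic_subset_Iic.2 hyx) h0)
  set A : Set ℝ≥0 := {x | μ (Iic x) ≠ 0} with hA
  obtain ⟨x₀, hx₀⟩ := hu.exists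
  have hne : A.Nonempty := ⟨x₀, (hiff x₀).2 (hfν x₀ hx₀)⟩
  set b := sInf A with hb
  have hlow : ∀ x ∈ A, b ≤ x := fun x hx => csInf_le (OrderBot.bddBelow A) hx
  -- by right-continuity, the bounds on the payoffs hold at the infimum as well
  have hlim : ∀ {f : ℝ≥0 → ℝ} {u : ℝ}, ContinuousWithinAt f (Ici b) b →
      (∀ x ∈ A, ∃ y ≤ x, u ≤ f y) → (∀ y, u ≤ f y → y ∈ A) → u ≤ f b := by
    intro f u hf h1 h2
    refine ge_of_tendsto_of_frequently hf.tendsto ?_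
    intro hev
    obtain ⟨z, hz, hsub⟩ := (mem_nhdsGE_iff_exists_Ico_subset' (lt_add_one b)).1 hev
    obtain ⟨x, hxA, hxz⟩ := exists_lt_of_csInf_lt hne (show sInf A < z from hz)
    obtain ⟨y, hyx, hy⟩ := h1 x hxA
    exact hsub ⟨hlow y (h2 y hy), hyx.trans_lt hxz⟩ hy
  have hfb : u ≤ f b := hlim (hf b) (fun x hx => key hu x hx) fun y hy => (hiff y).2 (hfν y hy)
  have hgb : t ≤ g b := hlim (hg b) (fun x hx => key ht x ((hiff x).1 hx)) fun y hy => hgμ y hy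
  have hatom : ∀ {μ : Measure ℝ≥0} {f : ℝ≥0 → ℝ} {u : ℝ}, (∀ᵐ x ∂μ, u ≤ f x) →
      (∀ y, u ≤ f y → y ∈ A) → μ (Iic b) ≠ 0 → μ {b} ≠ 0 := by
    intro μ f u hu h2 hμ h0
    obtain ⟨y, ⟨hy, hyb⟩, hne⟩ := ((hu.and_frequently (frequently_ae_mem_iff.2 hμ)).and_eventually
      (compl_mem_ae_iff.2 h0)).exists
    exact hne (le_antisymm hyb (hlow y (h2 y hy)))
  exact ⟨b, hatom hu (fun y hy => (hiff y).2 (hfν y hy)) (hgμ b hgb),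
    hatom ht (fun y hy => hgμ y hy) (hfν b hfb)⟩

end WinPayoff

/-! ### Winning probabilities and profiles with two active players -/

section Win

variable {ι : Type*} [Fintype ι] {C : Contest ι}

theorem p_le_one (a : ι) (s : ι → ℝ≥0) : C.p a s ≤ 1 :=
  (Finset.single_le_sum (fun _ _ => zero_le) (Finset.mem_univ a)).trans (C.sum_p s).le

theorem p_eq_one {a : ι} {s : ι → ℝ≥0} (h : ∀ k, k ≠ a → s k < s a) : C.p a s = 1 := by
  rw [← C.sum_p s]
  exact (Finset.sum_eq_single_of_mem a (Finset.mem_univ a)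
    fun k _ hk => C.p_eq_zero k a s (h k hk)).symm

end Win

section Pair

variable {ι : Type*} [DecidableEq ι]

theorem pairProfile_apply_left (a b : ι) (x y : ℝ≥0) : pairProfile a b x y a = x := by
  simp [pairProfile]

theorem pairProfile_apply_right {a b : ι} (hab : a ≠ b) (x y : ℝ≥0) :
    pairProfile a b x y b = y := by
  simp [pairProfile, hab.symm]

theorem pairProfile_apply_of_ne {a b k : ι} (ha : k ≠ a) (hb : k ≠ b) (x y : ℝ≥0) :
    pairProfile a b x y k = 0 := by
  simp [pairProfile, ha, hb]

theorem pairProfile_swap {a b : ι} (hab : a ≠ b) (x y : ℝ≥0) :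
    pairProfile a b x y = pairProfile b a y x :=
  Function.update_comm hab.symm _ _ _

theorem update_pairProfile {a b : ι} (x y : ℝ≥0) :
    Function.update (pairProfile b a y 0) a x = pairProfile a b x y := by
  by_cases hab : a = b
  · subst hab; ext k; by_cases hk : k = a <;> simp [pairProfile, hk]
  · rw [pairProfile_swap (Ne.symm hab), pairProfile, pairProfile, Function.update_idem]

theorem pairProfile_le {a b : ι} {x y z : ℝ≥0} (hx : x ≤ z) (hy : y ≤ z) (k : ι) :
    pairProfile a b x y k ≤ z := by
  by_cases ha : k = a
  · subst ha; rwa [pairProfile_apply_left]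
  · by_cases hb : k = b
    · subst hb; rwa [pairProfile_apply_right (Ne.symm ha)]
    · rw [pairProfile_apply_of_ne ha hb]; exact zero_le

theorem eq_pairProfile {a b : ι} {s : ι → ℝ≥0} (hab : a ≠ b) (hs : ∀ k, k ≠ a → k ≠ b → s k = 0) :
    s = pairProfile a b (s a) (s b) := by
  ext k
  by_cases ha : k = a
  · subst ha; rw [pairProfile_apply_left]
  · by_cases hb : k = b
    · subst hb; rw [pairProfile_apply_right hab]
    · rw [pairProfile_apply_of_ne ha hb, hs k ha hb]

theorem continuous_pairProfile (a b : ι) :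
    Continuous fun q : ℝ≥0 × ℝ≥0 => pairProfile a b q.1 q.2 := by
  unfold pairProfile
  fun_prop

variable [Fintype ι] (C : Contest ι)

/-- The value of the prize for `a` at the own score `x`, when `b` scores `y` and all others
score zero. -/
noncomputable def pairValue (a b : ι) (x y : ℝ≥0) : ℝ≥0 :=
  C.v a (pairProfile a b x y)

variable {C}

theorem Smoothness.continuousOn_pairValue (h : C.Smoothness) (a b : ι) :
    ContinuousOn (fun q : ℝ≥0 × ℝ≥0 => C.pairValue a b q.1 q.2) {q | q.2 ≤ q.1} :=
  (h a).1.comp (continuous_pairProfile a b).continuousOn fun q hq k _ => by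
    rw [pairProfile_apply_left]
    exact pairProfile_le le_rfl hq k

theorem Smoothness.continuous_c (h : C.Smoothness) (a : ι) : Continuous (C.c a) := by
  have h1 : ContinuousOn (C.costOwn a) (Ici 0) := (h a).2.2.continuousOn
  have h2 : Continuous fun x : ℝ≥0 => C.costOwn a x :=
    h1.comp_continuous NNReal.continuous_coe fun x => x.2
  exact NNReal.isEmbedding_coe.continuous_iff.2 (by simpa [costOwn, Function.comp_def] using h2)

theorem Monotonicity.c_pos (h : C.Monotonicity) (h' : C.Smoothness) (h0 : C.Interiority) (a : ι)
    {x : ℝ≥0} (hx : 0 < x) : 0 < C.c a x := by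
  have hmono : StrictMonoOn (C.costOwn a) (Ici 0) := by
    refine strictMonoOn_of_deriv_pos (convex_Ici 0) (h' a).2.2.continuousOn fun z hz => ?_
    rw [interior_Ici] at hz
    rw [← derivWithin_of_mem_nhds (Ici_mem_nhds hz)]
    exact (h a z hz).1
  have := hmono (mem_Ici.2 le_rfl) (mem_Ici.2 x.2) (show (0 : ℝ) < x from hx)
  simpa [costOwn, (h0 a).1] using this

/-! ### The two-player contest -/

/-- Winning probability of a player with the score `x` against the score `y`, if she wins ties
with probability `t`. -/
noncomputable def tieWin (t x y : ℝ≥0) : ℝ≥0 :=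
  if y < x then 1 else if x < y then 0 else t

theorem measurable_tieWin (t x : ℝ≥0) : Measurable (tieWin t x) :=
  Measurable.ite measurableSet_Iio measurable_const
    (Measurable.ite measurableSet_Ioi measurable_const measurable_const)

theorem tieWin_le_one {t : ℝ≥0} (ht : t ≤ 1) (x y : ℝ≥0) : tieWin t x y ≤ 1 := by
  unfold tieWin; split_ifs <;> simp [ht]

theorem tieWin_of_lt (t : ℝ≥0) {x y : ℝ≥0} (h : y < x) : tieWin t x y = 1 := if_pos h

theorem tieWin_of_gt (t : ℝ≥0) {x y : ℝ≥0} (h : x < y) : tieWin t x y = 0 := by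
  simp [tieWin, h, h.not_gt]

theorem tieWin_self (t x : ℝ≥0) : tieWin t x x = t := by simp [tieWin]

/-- Payoff of `a` against the strategy `μ` of `b` in the contest between these two, if `a` wins
ties with probability `t`. -/
noncomputable def duelPayoff (C : Contest ι) (a b : ι) (t : ℝ≥0) (μ : Measure ℝ≥0)
    (x : ℝ≥0) : ℝ :=
  ∫ y, ((tieWin t x y : ℝ) * C.pairValue a b x y - C.c a x) ∂μ

theorem measurable_mul_pairValue (h : C.Smoothness) (a b : ι) {x : ℝ≥0} {q : ℝ≥0 → ℝ≥0}
    (hq : Measurable q) (hgt : ∀ y, x < y → q y = 0) :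
    Measurable fun y => (q y : ℝ) * C.pairValue a b x y := by
  have : (fun y => (q y : ℝ) * C.pairValue a b x y) =
      fun y => (q y : ℝ) * (Iic x).indicator (fun y => (C.pairValue a b x y : ℝ)) y := by
    ext y
    by_cases hy : y ∈ Iic x
    · rw [indicator_of_mem hy]
    · rw [indicator_of_notMem hy, hgt y (not_le.1 hy)]; simp
  rw [this]
  exact hq.coe_nnreal_real.mul (measurable_indicator_Iic (h.continuousOn_pairValue a b) x)

theorem pair_payoffAgainst_zero (h : C.Smoothness) (i j : ι) {l : ℝ≥0} (hl : l ≤ 1)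
    (G : Fin 2 → ProbabilityMeasure ℝ≥0) (x : ℝ≥0) :
    (C.pair i j l hl).payoffAgainst 0 G x = C.duelPayoff i j l (G 1) x := by
  rw [payoffAgainst, duelPayoff,
    ← integral_comp_eval (μ := fun k => (G k : Measure ℝ≥0)) (i := 1)
      ((measurable_mul_pairValue h i j (measurable_tieWin l x)
        fun _ => tieWin_of_gt l).sub_const _).aestronglyMeasurable]
  refine integral_congr_ae (Eventually.of_forall fun s => ?_)
  simp [payoff, pair, pairWin, tieWin, pairValue]

theorem pair_payoffAgainst_one (h : C.Smoothness) {i j : ι} (hij : i ≠ j) {l : ℝ≥0} (hl : l ≤ 1)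
    (G : Fin 2 → ProbabilityMeasure ℝ≥0) (x : ℝ≥0) :
    (C.pair i j l hl).payoffAgainst 1 G x = C.duelPayoff j i (1 - l) (G 0) x := by
  rw [payoffAgainst, duelPayoff,
    ← integral_comp_eval (μ := fun k => (G k : Measure ℝ≥0)) (i := 0)
      ((measurable_mul_pairValue h j i (measurable_tieWin (1 - l) x)
        fun _ => tieWin_of_gt (1 - l)).sub_const _).aestronglyMeasurable]
  refine integral_congr_ae (Eventually.of_forall fun s => ?_)
  simp [payoff, pair, pairWin, tieWin, pairValue, pairProfile_swap hij.symm]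

theorem expectedPayoff_zero_nonpos (D : Contest (Fin 2)) (G : Fin 2 → ProbabilityMeasure ℝ≥0)
    (h : ∀ x, D.payoffAgainst 0 G x ≤ 0) : D.expectedPayoff 0 G ≤ 0 := by
  by_cases hint : Integrable (D.payoff 0) (Measure.pi fun k => (G k : Measure ℝ≥0))
  swap
  -- the integral of a function that is not integrable is zero by convention
  · rw [expectedPayoff, integral_undef hint]
  have hmp := (measurePreserving_piFinTwo fun k => (G k : Measure ℝ≥0)).symm
  have hint' := (hmp.integrable_comp_emb (MeasurableEquiv.measurableEmbedding _)).2 hint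
  rw [expectedPayoff, ← hmp.integral_comp' (D.payoff 0)]
  refine (integral_prod _ hint').trans_le ?_
  have hD : ∀ᵐ x ∂(G 0 : Measure ℝ≥0), ∫ y, D.payoff 0
      ((MeasurableEquiv.piFinTwo fun _ => ℝ≥0).symm (x, y)) ∂(G 1 : Measure ℝ≥0) ≤ 0 := by
    filter_upwards [hint'.prod_right_ae] with x hx
    refine le_of_eq_of_le ?_ (h x)
    rw [payoffAgainst, ← integral_comp_eval (μ := fun k => (G k : Measure ℝ≥0)) (i := 1)
      (f := fun y => D.payoff 0 ((MeasurableEquiv.piFinTwo fun _ => ℝ≥0).symm (x, y)))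
      hx.aestronglyMeasurable]
    refine integral_congr_ae (Eventually.of_forall fun s => ?_)
    have : Function.update s 0 x = (MeasurableEquiv.piFinTwo fun _ => ℝ≥0).symm (x, s 1) := by
      ext k; fin_cases k <;> simp [MeasurableEquiv.piFinTwo]
    simp only [this]
  exact integral_nonpos_of_ae hD

/-! ### Equilibria of the two-player contest -/

theorem duelPayoff_le_winPayoff (h : C.Smoothness) (a b : ι) {t : ℝ≥0} (ht : t ≤ 1)
    (μ : Measure ℝ≥0) [IsProbabilityMeasure μ] (x : ℝ≥0) :
    C.duelPayoff a b t μ x ≤ winPayoff (C.pairValue a b) (C.c a) μ x :=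
  integral_sub_le_winPayoff (h.continuousOn_pairValue a b) (measurable_tieWin t x)
    (tieWin_le_one ht x) fun _ => tieWin_of_gt t

theorem duelPayoff_eq_winPayoff (h : C.Smoothness) (a b : ι) (t : ℝ≥0)
    (μ : Measure ℝ≥0) [IsProbabilityMeasure μ] {x : ℝ≥0} (hx : μ {x} = 0) :
    C.duelPayoff a b t μ x = winPayoff (C.pairValue a b) (C.c a) μ x :=
  integral_sub_eq_winPayoff (h.continuousOn_pairValue a b) (fun _ => tieWin_of_lt t)
    (fun _ => tieWin_of_gt t) hx

/-- A player who loses some of the ties at an atom of the opponent's strategy, where the prize has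
a positive value, would get strictly more by winning them all. -/
theorem duelPayoff_lt_winPayoff (h : C.Smoothness) (a b : ι) {t : ℝ≥0} (ht : t < 1)
    (μ : Measure ℝ≥0) [IsProbabilityMeasure μ] {x : ℝ≥0} (hx : μ {x} ≠ 0)
    (hv : 0 < C.pairValue a b x x) :
    C.duelPayoff a b t μ x < winPayoff (C.pairValue a b) (C.c a) μ x := by
  have hint := integrable_indicator_Iic (μ := μ) (h.continuousOn_pairValue a b) x
  have heq : ∀ y, (tieWin t x y : ℝ) * C.pairValue a b x y - C.c a x =
      (Iic x).indicator (fun y => (C.pairValue a b x y : ℝ)) y -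
        ({x} : Set ℝ≥0).indicator (fun _ => (1 - t : ℝ) * C.pairValue a b x x) y - C.c a x := by
    intro y
    rcases lt_trichotomy y x with hy | hy | hy
    · simp [tieWin_of_lt t hy, hy.le, hy.ne]
    · subst hy; simp [tieWin_self]; ring
    · simp [tieWin_of_gt t hy, hy, hy.ne']
  have hs : Integrable (({x} : Set ℝ≥0).indicator
      fun _ => (1 - t : ℝ) * C.pairValue a b x x) μ :=
    (integrable_const _).indicator (measurableSet_singleton x)
  rw [duelPayoff, integral_congr_ae (Eventually.of_forall heq),
    integral_sub (by exact hint.sub hs) (integrable_const _), integral_sub hint hs, integral_const,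
    probReal_univ, one_smul, winPayoff_eq_integral_indicator,
    integral_indicator (measurableSet_singleton x), setIntegral_const]
  have h1 : 0 < μ.real {x} := ENNReal.toReal_pos hx (measure_ne_top _ _)
  have h2 : (0 : ℝ) < 1 - t := sub_pos.2 (by exact_mod_cast ht)
  have h3 : (0 : ℝ) < C.pairValue a b x x := by exact_mod_cast hv
  have h4 := mul_pos h1 (mul_pos h2 h3)
  simp only [smul_eq_mul]
  linarith

theorem duelPayoff_zero_nonneg (h0 : C.Interiority) (a b : ι) (t : ℝ≥0) (μ : Measure ℝ≥0) :
    0 ≤ C.duelPayoff a b t μ 0 :=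
  integral_nonneg fun y => by simp only [(h0 a).1]; simpa using by positivity

/-- From the score bound on, a payoff is negative even if all ties are won. -/
theorem winPayoff_neg (h : C.Smoothness) {T : ι → ℝ≥0} (hT : C.IsScoreBound T) (a b : ι)
    (μ : Measure ℝ≥0) [IsProbabilityMeasure μ] {x : ℝ≥0} (hx : T a ≤ x) :
    winPayoff (C.pairValue a b) (C.c a) μ x < 0 := by
  have hcont := continuousOn_Iic_of_continuousOn (h.continuousOn_pairValue a b) x
  have hIcc : Icc 0 x = Iic x := by ext; simp
  obtain ⟨y, hy, hmax⟩ := (hIcc ▸ isCompact_Icc : IsCompact (Iic x)).exists_isMaxOn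
    ⟨x, self_mem_Iic⟩ hcont
  have hlt : C.pairValue a b x y < C.c a x := by
    have := hT a (pairProfile a b x y) (by rwa [pairProfile_apply_left])
      fun k => by rw [pairProfile_apply_left]; exact pairProfile_le le_rfl hy k
    rwa [pairProfile_apply_left] at this
  have hle : ∫ y in Iic x, (C.pairValue a b x y : ℝ) ∂μ ≤ C.pairValue a b x y := by
    rw [← integral_indicator measurableSet_Iic]
    refine (integral_mono (integrable_indicator_Iic (h.continuousOn_pairValue a b) x)
      (integrable_const (C.pairValue a b x y : ℝ)) fun z => ?_).trans_eq (by simp)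
    exact indicator_le' (fun z hz => hmax hz) (fun _ _ => NNReal.coe_nonneg _) z
  have : (C.pairValue a b x y : ℝ) < C.c a x := by exact_mod_cast hlt
  rw [winPayoff]
  linarith

end Pair

section Equilibrium

variable {ι : Type*} [Fintype ι] [DecidableEq ι] {C : Contest ι}

/-- The equilibrium payoff is an upper bound even if the player were to win all ties: instead of
winning a tie for sure, she can score slightly more, avoiding the atoms of the opponent. -/
theorem winPayoff_le_duelPayoff (h : C.Smoothness) (a b : ι) {t : ℝ≥0} {μ : Measure ℝ≥0}
    [IsProbabilityMeasure μ] {x : ℝ≥0}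
    (hx : ∀ z, C.duelPayoff a b t μ z ≤ C.duelPayoff a b t μ x) (z : ℝ≥0) :
    winPayoff (C.pairValue a b) (C.c a) μ z ≤ C.duelPayoff a b t μ x :=
  le_of_forall_measure_singleton_eq_zero (μ := μ)
    (continuousWithinAt_winPayoff (h.continuousOn_pairValue a b) (h.continuous_c a) z)
    fun y hy => (duelPayoff_eq_winPayoff h a b t μ hy).symm.trans_le (hx y)

theorem duelPayoff_eq_winPayoff_of_best (h : C.Smoothness) (a b : ι) {t : ℝ≥0} (ht : t ≤ 1)
    {μ : Measure ℝ≥0} [IsProbabilityMeasure μ] {x : ℝ≥0}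
    (hx : ∀ z, C.duelPayoff a b t μ z ≤ C.duelPayoff a b t μ x) :
    C.duelPayoff a b t μ x = winPayoff (C.pairValue a b) (C.c a) μ x :=
  le_antisymm (duelPayoff_le_winPayoff h a b ht μ x) (winPayoff_le_duelPayoff h a b hx x)

theorem lt_scoreBound_of_best (h : C.Smoothness) (h0 : C.Interiority) {T : ι → ℝ≥0}
    (hT : C.IsScoreBound T) (a b : ι) {t : ℝ≥0} (ht : t ≤ 1) {μ : Measure ℝ≥0}
    [IsProbabilityMeasure μ] {x : ℝ≥0}
    (hx : ∀ z, C.duelPayoff a b t μ z ≤ C.duelPayoff a b t μ x) : x < T a := by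
  by_contra hTx
  have h1 := winPayoff_neg h hT a b μ (not_lt.1 hTx)
  have h2 := duelPayoff_le_winPayoff h a b ht μ x
  have h3 := duelPayoff_zero_nonneg h0 a b t μ
  linarith [hx 0]

/-- In an equilibrium of the two-player contest, the strategies have no common atom: one of the
players does not win all the ties, and would rather score slightly more. -/
theorem measure_singleton_eq_zero_of_equilibrium (h : C.Smoothness) (h0 : C.Interiority)
    (h4 : C.DiscontinuityAtTies) {a b : ι} (hab : a ≠ b) {t : ℝ≥0} (ht : t ≤ 1)
    {μ ν : Measure ℝ≥0} [IsProbabilityMeasure μ] [IsProbabilityMeasure ν]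
    (hμ : ∀ᵐ x ∂μ, ∀ z, C.duelPayoff a b t ν z ≤ C.duelPayoff a b t ν x)
    (hν : ∀ᵐ x ∂ν, ∀ z, C.duelPayoff b a (1 - t) μ z ≤ C.duelPayoff b a (1 - t) μ x)
    {x : ℝ≥0} (hx : μ {x} ≠ 0) : ν {x} = 0 := by
  by_contra hxν
  obtain ⟨y, hy, rfl⟩ := (hμ.and_frequently (frequently_ae_mem_iff.2 hx)).exists
  obtain ⟨z, hz, rfl⟩ := (hν.and_frequently (frequently_ae_mem_iff.2 hxν)).exists
  obtain ⟨T, hT, hv⟩ := h4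
  have h1t : 1 - t ≤ 1 := tsub_le_self
  have hzT : ∀ k, pairProfile a b z z k ≤ T k := by
    intro k
    by_cases ha : k = a
    · subst ha
      rw [pairProfile_apply_left]
      exact (lt_scoreBound_of_best h h0 hT _ b ht hy).le
    · by_cases hb : k = b
      · subst hb
        rw [pairProfile_apply_right hab]
        exact (lt_scoreBound_of_best h h0 hT _ a h1t hz).le
      · rw [pairProfile_apply_of_ne ha hb]; exact zero_le
  have hleft : pairProfile a b z z a = z := pairProfile_apply_left a b z z
  have hright : pairProfile a b z z b = z := pairProfile_apply_right hab z z
  have hva : 0 < C.pairValue a b z z :=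
    hv a _ hzT (fun k => hleft.symm ▸ pairProfile_le le_rfl le_rfl k)
      ⟨b, hab.symm, hright.trans hleft.symm⟩
  have hvb : 0 < C.pairValue b a z z := by
    rw [pairValue, ← pairProfile_swap hab]
    exact hv b _ hzT (fun k => hright.symm ▸ pairProfile_le le_rfl le_rfl k)
      ⟨a, hab, hleft.trans hright.symm⟩
  rcases ht.lt_or_eq with ht1 | rfl
  · exact (duelPayoff_lt_winPayoff h a b ht1 ν hxν hva).ne
      (duelPayoff_eq_winPayoff_of_best h a b ht hy)
  · exact (duelPayoff_lt_winPayoff h b a (by simp) μ hx hvb).ne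
      (duelPayoff_eq_winPayoff_of_best h b a h1t hz)

/-! ### The contest with all players, of whom two are active -/

section Active

variable {F : ι → ProbabilityMeasure ℝ≥0} {a b : ι}

theorem ae_eq_zero_of_dirac (hF : ∀ k, k ≠ a → k ≠ b → (F k : Measure ℝ≥0) = Measure.dirac 0) :
    ∀ᵐ s ∂(Measure.pi fun k => (F k : Measure ℝ≥0)), ∀ k, k ≠ a → k ≠ b → s k = 0 := by
  refine eventually_all.2 fun k => ?_
  by_cases hk : k ≠ a ∧ k ≠ b
  · have h1 : ∀ᵐ x ∂(F k : Measure ℝ≥0), x = 0 := by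
      rw [hF k hk.1 hk.2, ae_dirac_eq]; exact rfl
    filter_upwards [(Measure.tendsto_eval_ae_ae
      (μ := fun k => (F k : Measure ℝ≥0)) (i := k)).eventually h1] with s hs _ _
    exact hs
  · exact Eventually.of_forall fun s ha hb => absurd ⟨ha, hb⟩ hk

theorem measurable_p_pairProfile (a b : ι) (x : ℝ≥0) :
    Measurable fun y => C.p a (pairProfile a b x y) :=
  (C.measurable_p a).comp ((continuous_pairProfile a b).comp (Continuous.prodMk_right x)).measurable

/-- As the inactive players score zero, the payoff of an active player is an integral over the
score of the other active player only. -/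
theorem payoffAgainst_active (h : C.Smoothness) (hab : a ≠ b)
    (hF : ∀ k, k ≠ a → k ≠ b → (F k : Measure ℝ≥0) = Measure.dirac 0) (x : ℝ≥0) :
    C.payoffAgainst a F x = ∫ y, ((C.p a (pairProfile a b x y) : ℝ) * C.pairValue a b x y -
      C.c a x) ∂(F b : Measure ℝ≥0) := by
  have hgt : ∀ y, x < y → C.p a (pairProfile a b x y) = 0 := fun y hy =>
    C.p_eq_zero a b _ (by rwa [pairProfile_apply_left, pairProfile_apply_right hab])
  rw [payoffAgainst, ← integral_comp_eval (μ := fun k => (F k : Measure ℝ≥0)) (i := b)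
      ((measurable_mul_pairValue h a b (measurable_p_pairProfile a b x)
        hgt).sub_const _).aestronglyMeasurable]
  refine integral_congr_ae ?_
  filter_upwards [ae_eq_zero_of_dirac hF] with s hs
  have : Function.update s a x = pairProfile a b x (s b) := by
    have h1 := eq_pairProfile (s := Function.update s a x) hab fun k ha hb => by
      rw [Function.update_of_ne ha, hs k ha hb]
    rwa [Function.update_self, Function.update_of_ne hab.symm] at h1
  rw [this, payoff, pairProfile_apply_left, pairValue]

theorem payoffAgainst_active_le (h : C.Smoothness) (hab : a ≠ b)
    (hF : ∀ k, k ≠ a → k ≠ b → (F k : Measure ℝ≥0) = Measure.dirac 0) (x : ℝ≥0) :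
    C.payoffAgainst a F x ≤ winPayoff (C.pairValue a b) (C.c a) (F b) x := by
  rw [payoffAgainst_active h hab hF]
  refine integral_sub_le_winPayoff (h.continuousOn_pairValue a b)
    (measurable_p_pairProfile a b x)
    (fun y => p_le_one a _) fun y hy => ?_
  exact C.p_eq_zero a b _ (by rwa [pairProfile_apply_left, pairProfile_apply_right hab])

theorem payoffAgainst_active_eq (h : C.Smoothness) (hab : a ≠ b)
    (hF : ∀ k, k ≠ a → k ≠ b → (F k : Measure ℝ≥0) = Measure.dirac 0) {x : ℝ≥0}
    (hx : (F b : Measure ℝ≥0) {x} = 0) :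
    C.payoffAgainst a F x = winPayoff (C.pairValue a b) (C.c a) (F b) x := by
  rw [payoffAgainst_active h hab hF]
  refine integral_sub_eq_winPayoff (h.continuousOn_pairValue a b) (fun y hy => ?_)
    (fun y hy => ?_) hx
  · refine p_eq_one fun k hk => ?_
    rw [pairProfile_apply_left]
    by_cases hb : k = b
    · subst hb; rwa [pairProfile_apply_right hab]
    · rw [pairProfile_apply_of_ne hk hb]; exact zero_le.trans_lt hy
  · exact C.p_eq_zero a b _ (by rwa [pairProfile_apply_left, pairProfile_apply_right hab])

/-- Without common atoms, the change of the tie-breaking rule, and the additional players at the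
score zero, do not matter for an active player. -/
theorem ae_mem_bestResponses_active (h : C.Smoothness) (hab : a ≠ b)
    (hF : ∀ k, k ≠ a → k ≠ b → (F k : Measure ℝ≥0) = Measure.dirac 0) {t : ℝ≥0} (ht : t ≤ 1)
    (hbr : ∀ᵐ x ∂(F a : Measure ℝ≥0),
      ∀ z, C.duelPayoff a b t (F b) z ≤ C.duelPayoff a b t (F b) x)
    (hatom : ∀ x, (F a : Measure ℝ≥0) {x} ≠ 0 → (F b : Measure ℝ≥0) {x} = 0) :
    ∀ᵐ x ∂(F a : Measure ℝ≥0), x ∈ C.bestResponses a F := by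
  filter_upwards [hbr, ae_measure_singleton_eq_zero_of_no_common_atom hatom] with x hx hx0 z
  calc C.payoffAgainst a F z ≤ winPayoff (C.pairValue a b) (C.c a) (F b) z :=
        payoffAgainst_active_le h hab hF z
    _ ≤ C.duelPayoff a b t (F b) x := winPayoff_le_duelPayoff h a b hx z
    _ = C.payoffAgainst a F x := by
        rw [payoffAgainst_active_eq h hab hF hx0, duelPayoff_eq_winPayoff_of_best h a b ht hx]

end Active

/-! ### The inactive players -/

section Inactive

variable {F : ι → ProbabilityMeasure ℝ≥0} {i j k : ι}

theorem RankedCosts.mul_le (hrank : C.RankedCosts i j) (hki : k ≠ i) (hkj : k ≠ j)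
    {x : ℝ≥0} (hx : 0 < C.c j x) (a b : ℝ≥0) :
    C.v k (Function.update (pairProfile i j a b) k x) * C.c j x ≤
      C.c k x * C.pairValue j i x a := by
  have h := hrank k hki hkj x a b
  rw [update_pairProfile] at h
  change (C.c j x : ℝ≥0∞) / C.pairValue j i x a ≤ _ at h
  set V := C.v k (Function.update (pairProfile i j a b) k x)
  set W := C.pairValue j i x a
  by_cases hV : V = 0
  · simp [hV]
  have hcj : (C.c j x : ℝ≥0∞) ≠ 0 := by exact_mod_cast hx.ne'
  have hV' : (V : ℝ≥0∞) ≠ 0 := by exact_mod_cast hV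
  have hfin : (C.c k x : ℝ≥0∞) / V ≠ ∞ := ENNReal.div_ne_top ENNReal.coe_ne_top hV'
  have hW : W ≠ 0 := by
    intro hW
    rw [hW, ENNReal.coe_zero, ENNReal.div_zero hcj] at h
    exact hfin (top_le_iff.1 h)
  rw [← ENNReal.coe_div hW, ← ENNReal.coe_div hV, ENNReal.coe_le_coe,
    div_le_div_iff₀ (pos_iff_ne_zero.2 hW) (pos_iff_ne_zero.2 hV)] at h
  rwa [mul_comm]

theorem payoffAgainst_inactive_zero (h0 : C.Interiority) (hki : k ≠ i)
    (hi : (F i : Measure ℝ≥0) {0} = 0) : C.payoffAgainst k F 0 = 0 := by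
  refine integral_eq_zero_of_ae ?_
  filter_upwards [(Measure.tendsto_eval_ae_ae (μ := fun k => (F k : Measure ℝ≥0))
    (i := i)).eventually (compl_mem_ae_iff.2 hi)] with s hs
  have hp : C.p k (Function.update s k 0) = 0 := by
    refine C.p_eq_zero k i _ ?_
    rw [Function.update_self, Function.update_of_ne hki.symm]
    exact pos_iff_ne_zero.2 hs
  simp [payoff, hp, (h0 k).1]

/-- By the ranking of the costs, an inactive player who deviates to the score `x` gets at most
`c k x / c j x` times what `j` would get from `x` by winning all ties. -/
theorem payoffAgainst_inactive_nonpos (h : C.Smoothness) (hij : i ≠ j)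
    (hrank : C.RankedCosts i j) (hki : k ≠ i) (hkj : k ≠ j)
    (hF : ∀ k, k ≠ i → k ≠ j → (F k : Measure ℝ≥0) = Measure.dirac 0) {x : ℝ≥0}
    (hx : 0 < C.c j x) (hwin : winPayoff (C.pairValue j i) (C.c j) (F i) x ≤ 0) :
    C.payoffAgainst k F x ≤ 0 := by
  by_cases hint : Integrable (fun s => C.payoff k (Function.update s k x))
      (Measure.pi fun k => (F k : Measure ℝ≥0))
  swap
  -- this case does not occur, as the integrand is bounded and measurable, but it is harmless
  · rw [payoffAgainst, integral_undef hint]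
  set g : ℝ≥0 → ℝ := fun y => (C.c k x / C.c j x : ℝ) *
    ((Iic x).indicator (fun y => (C.pairValue j i x y : ℝ)) y - C.c j x) with hg
  have hind := integrable_indicator_Iic (μ := F i) (h.continuousOn_pairValue j i) x
  have hgint : Integrable g (F i) := (hind.sub (integrable_const _)).const_mul _
  have hcj : (0 : ℝ) < C.c j x := by exact_mod_cast hx
  have hle : (fun s => C.payoff k (Function.update s k x))
      ≤ᵐ[Measure.pi fun k => (F k : Measure ℝ≥0)] fun s => g (s i) := by
    filter_upwards [ae_eq_zero_of_dirac hF] with s hs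
    have hck : (C.c k x / C.c j x : ℝ) * C.c j x = C.c k x := div_mul_cancel₀ _ hcj.ne'
    simp only [hg, mul_sub, hck, payoff, Function.update_self]
    refine sub_le_sub_right ?_ _
    by_cases hsx : s i ≤ x
    · rw [indicator_of_mem (mem_Iic.2 hsx)]
      have h1 := hrank.mul_le hki hkj hx (s i) (s j)
      rw [← eq_pairProfile hij hs] at h1
      have h2 : (C.v k (Function.update s k x) : ℝ) * C.c j x ≤
          C.c k x * C.pairValue j i x (s i) := by exact_mod_cast h1
      refine (mul_le_of_le_one_left (NNReal.coe_nonneg _)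
        (by exact_mod_cast p_le_one k _)).trans ?_
      rwa [div_mul_eq_mul_div, le_div_iff₀ hcj]
    · have hp : C.p k (Function.update s k x) = 0 := C.p_eq_zero k i _ (by
        rw [Function.update_self, Function.update_of_ne hki.symm]; exact not_le.1 hsx)
      rw [indicator_of_notMem (by simpa using hsx), hp]
      simp
  have hgint' : Integrable (fun s : ι → ℝ≥0 => g (s i))
      (Measure.pi fun k => (F k : Measure ℝ≥0)) :=
    (measurePreserving_eval (fun k => (F k : Measure ℝ≥0)) i).integrable_comp_of_integrable hgint
  calc C.payoffAgainst k F x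
      ≤ ∫ s, g (s i) ∂(Measure.pi fun k => (F k : Measure ℝ≥0)) :=
        integral_mono_ae hint hgint' hle
    _ = ∫ y, g y ∂(F i : Measure ℝ≥0) :=
        integral_comp_eval (μ := fun k => (F k : Measure ℝ≥0)) hgint.aestronglyMeasurable
    _ = (C.c k x / C.c j x : ℝ) * winPayoff (C.pairValue j i) (C.c j) (F i) x := by
        rw [hg, integral_const_mul, integral_sub hind (integrable_const _), integral_const,
          probReal_univ, one_smul, winPayoff_eq_integral_indicator]
    _ ≤ 0 := mul_nonpos_of_nonneg_of_nonpos (by positivity) hwin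

end Inactive

end Equilibrium

end Contest

/-! ### The equilibrium with two active players -/

open Contest in
theorem theorem3 {ι : Type*} [Fintype ι] [DecidableEq ι] (hn : 2 < Fintype.card ι)
    (C : Contest ι) (h1 : C.Smoothness) (h2 : C.Monotonicity) (h3 : C.Interiority)
    (h4 : C.DiscontinuityAtTies) (i j : ι) (hij : i ≠ j)
    (l : ℝ≥0) (hl : l ≤ 1) (G : Fin 2 → ProbabilityMeasure ℝ≥0)
    (hG : (C.pair i j l hl).IsNash G) (hpos : 0 < (C.pair i j l hl).expectedPayoff 0 G)
    (hrank : C.RankedCosts i j) :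
    ∃ F : ι → ProbabilityMeasure ℝ≥0, C.IsNash F ∧ F i = G 0 ∧ F j = G 1 ∧
      ∀ k, k ≠ i → k ≠ j → (F k : Measure ℝ≥0) = Measure.dirac 0 := by
  have hbi : ∀ᵐ x ∂(G 0 : Measure ℝ≥0),
      ∀ z, C.duelPayoff i j l (G 1) z ≤ C.duelPayoff i j l (G 1) x := by
    simpa only [bestResponses, mem_ofPred_eq, pair_payoffAgainst_zero h1] using hG 0
  have hbj : ∀ᵐ x ∂(G 1 : Measure ℝ≥0),
      ∀ z, C.duelPayoff j i (1 - l) (G 0) z ≤ C.duelPayoff j i (1 - l) (G 0) x := by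
    simpa only [bestResponses, mem_ofPred_eq, pair_payoffAgainst_one h1 hij] using hG 1
  have hl' : 1 - l ≤ 1 := tsub_le_self
  have hatom : ∀ x, (G 0 : Measure ℝ≥0) {x} ≠ 0 → (G 1 : Measure ℝ≥0) {x} = 0 := fun x =>
    measure_singleton_eq_zero_of_equilibrium h1 h3 h4 hij hl hbi hbj
  have hatom' : ∀ x, (G 1 : Measure ℝ≥0) {x} ≠ 0 → (G 0 : Measure ℝ≥0) {x} = 0 := fun x hx => by
    by_contra h; exact hx (hatom x h)
  -- almost every score of `i` yields the same positive payoff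
  obtain ⟨x₀, hx₀⟩ := hbi.exists
  have hu : 0 < C.duelPayoff i j l (G 1) x₀ := by
    by_contra hle
    refine hpos.not_ge (expectedPayoff_zero_nonpos _ G fun x => ?_)
    rw [pair_payoffAgainst_zero h1]
    exact (hx₀ x).trans (not_lt.1 hle)
  have hui : ∀ᵐ x ∂(G 0 : Measure ℝ≥0),
      C.duelPayoff i j l (G 1) x₀ ≤ winPayoff (C.pairValue i j) (C.c i) (G 1) x := by
    filter_upwards [hbi] with x hx
    exact (hx x₀).trans (duelPayoff_le_winPayoff h1 i j hl _ x)
  -- a positive payoff of `j` as well would give rise to a common atom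
  have hwj : ∀ x, winPayoff (C.pairValue j i) (C.c j) (G 0) x ≤ 0 := by
    obtain ⟨y₀, hy₀⟩ := hbj.exists
    intro x
    refine (winPayoff_le_duelPayoff h1 j i hy₀ x).trans (not_lt.1 fun ht => ?_)
    have htj : ∀ᵐ y ∂(G 1 : Measure ℝ≥0),
        C.duelPayoff j i (1 - l) (G 0) y₀ ≤ winPayoff (C.pairValue j i) (C.c j) (G 0) y := by
      filter_upwards [hbj] with y hy
      exact (hy y₀).trans (duelPayoff_le_winPayoff h1 j i hl' _ y)
    obtain ⟨b, hb0, hb1⟩ := exists_common_atom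
      (continuousWithinAt_winPayoff (h1.continuousOn_pairValue i j) (h1.continuous_c i))
      (continuousWithinAt_winPayoff (h1.continuousOn_pairValue j i) (h1.continuous_c j)) hui htj
      (fun x hx => measure_Iic_ne_zero_of_winPayoff_pos (hu.trans_le hx))
      (fun x hx => measure_Iic_ne_zero_of_winPayoff_pos (ht.trans_le hx))
    exact hb1 (hatom b hb0)
  -- an atom of `i` at zero would not be one of `j`, so that `i` would get nothing there
  have hi0 : (G 0 : Measure ℝ≥0) {0} = 0 := by
    by_contra h0
    obtain ⟨y, hy, rfl⟩ := (hui.and_frequently (frequently_ae_mem_iff.2 h0)).exists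
    refine measure_Iic_ne_zero_of_winPayoff_pos (hu.trans_le hy) ?_
    have hIic : Iic (0 : ℝ≥0) = {0} := by ext; simp
    rw [hIic]
    exact hatom 0 h0
  let F : ι → ProbabilityMeasure ℝ≥0 := fun k =>
    if k = i then G 0 else if k = j then G 1 else ⟨Measure.dirac 0, inferInstance⟩
  have hFi : F i = G 0 := if_pos rfl
  have hFj : F j = G 1 := by simp [F, hij.symm]
  have hF : ∀ k, k ≠ i → k ≠ j → (F k : Measure ℝ≥0) = Measure.dirac 0 := by
    intro k hki hkj
    simp [F, hki, hkj]
  refine ⟨F, fun k => ?_, hFi, hFj, hF⟩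
  by_cases hki : k = i
  · subst hki
    exact ae_mem_bestResponses_active h1 hij hF hl (by rwa [hFi, hFj]) (by rwa [hFi, hFj])
  by_cases hkj : k = j
  · subst hkj
    exact ae_mem_bestResponses_active h1 hij.symm (fun m hm hm' => hF m hm' hm) hl'
      (by rwa [hFi, hFj]) (by rwa [hFi, hFj])
  rw [hF k hki hkj, ae_dirac_eq]
  change ∀ x, C.payoffAgainst k F x ≤ C.payoffAgainst k F 0
  have hzero : C.payoffAgainst k F 0 = 0 := payoffAgainst_inactive_zero h3 hki (by rwa [hFi])
  intro x
  rw [hzero]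
  rcases eq_or_ne x 0 with rfl | hx
  · exact hzero.le
  · exact payoffAgainst_inactive_nonpos h1 hij hrank hki hkj hF
      (h2.c_pos h1 h3 j (pos_iff_ne_zero.2 hx)) (by rw [hFi]; exact hwj x)
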